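/- Let $\mathcal{A}=(\mathcal{A},\mathbb{E},\mathfrak{s})$ be a Krull–Schmidt extriangulated category (in the sense of Nakaoka–Palu). A length function on $\mathcal{A}$ is an isomorphism-invariant map $\Theta$ from the objects of $\mathcal{A}$ to $\mathbb{N}$ such that $\Theta(X)=0$ if and only if $X\cong 0$, and $\Theta(L)\le\Theta(X)+\Theta(M)$ for every $\mathbb{E}$-triangle $X\to L\to M\overset{\delta}{\dashrightarrow}$, with equality if $\delta=0$. An $\mathbb{E}$-triangle $X\xrightarrow{x}L\xrightarrow{y}M\dashrightarrow$ is stable if $\Theta(L)=\Theta(X)+\Theta(M)$; then $x$ is called a $\Theta$-inflation and $y$ a $\Theta$-deflation. Assume that $(\mathcal{A},\Theta)$ is a length category, i.e. $\Theta$ is a length function and every morphism of $\mathcal{A}$ is a composite $j\circ i$ of a $\Theta$-deflation $i$ and a $\Theta$-inflation $j$. All subcategories are full and closed under isomorphisms. For a subcategory (or object) $\mathcal{S}$, let $\mathrm{Fac}_\Theta(\mathcal{S})$ (resp. $\mathrm{Sub}_\Theta(\mathcal{S})$) be the class of objects $M$ admitting a $\Theta$-deflation $S\to M$ (resp. a $\Theta$-inflation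 $M\to S$) with $S\in\mathcal{S}$; let $\mathcal{S}^{\perp}=\{M\mid \mathrm{Hom}(\mathcal{S},M)=0\}$ and ${}^{\perp}\mathcal{S}=\{M\mid\mathrm{Hom}(M,\mathcal{S})=0\}$. A torsion class is a non-empty subcategory $\mathcal{T}$ with $\mathrm{Fac}_\Theta(\mathcal{T})\subseteq\mathcal{T}$ such that the middle term of every stable $\mathbb{E}$-triangle with both end terms in $\mathcal{T}$ lies in $\mathcal{T}$. Let $\mathrm{tors}_\Theta(\mathcal{A})$ be the set of torsion classes ordered by inclusion, and let $\mathrm{T}_\Theta(\mathcal{S})$ be the intersection of all torsion classes containing $\mathcal{S}$. A brick is an object whose endomorphism ring is a division ring. Let $\mathcal{U}\subseteq\mathcal{T}$ be torsion classes, let $[\mathcal{U},\mathcal{T}]=\{\mathcal{V}\in\mathrm{tors}_\Theta(\mathcal{A})\mid\mathcal{U}\subseteq\mathcal{V}\subseteq\mathcal{T}\}$, and let $\mathrm{brick}(\mathcal{U}^{\perp}\cap\mathcal{T})$ be the set of isomorphism classes of bricks lying in $\mathcal{U}^{\perp}\cap\mathcal{T}$. (1) $\#[\mathcal{U},\mathcal{T}]=1$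 if and only if $\mathrm{brick}(\mathcal{U}^{\perp}\cap\mathcal{T})=\emptyset$. (2) If $\#\,\mathrm{brick}(\mathcal{U}^{\perp}\cap\mathcal{T})=1$, then $\#[\mathcal{U},\mathcal{T}]=2$. (3) If $\#[\mathcal{U},\mathcal{T}]=2$, then there is a brick $S\in\mathrm{brick}(\mathcal{U}^{\perp}\cap\mathcal{T})$ such that (i) $\Theta(S)\le\Theta(S')$ for every $S'\in\mathrm{brick}(\mathcal{U}^{\perp}\cap\mathcal{T})$; (ii) $\mathcal{T}=\mathrm{T}_\Theta(\mathcal{U}\cup\{S\})$ and $\mathcal{U}=\mathcal{T}\cap{}^{\perp}S$; (iii) $S\in\mathrm{Sub}_\Theta(S')\cap\mathrm{Fac}_\Theta(S')$ for every $S'\in\mathrm{brick}(\mathcal{U}^{\perp}\cap\mathcal{T})$. Moreover, $S$ is unique up to isomorphism; in fact it is, up to isomorphism, the only brick in $\mathcal{U}^{\perp}\cap\mathcal{T}$ satisfying (i). -/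

import Mathlib

open CategoryTheory CategoryTheory.Limits Opposite

universe w v u

namespace ExtriLength

section Extriangulated

variable {C : Type u} [Category.{v} C]

/-- A sequence `X ⟶ mid ⟶ Z` with fixed end terms `X` and `Z`. -/
structure ThreeTerm (X Z : C) where
  mid : C
  i : X ⟶ mid
  p : mid ⟶ Z

/-- Two sequences with the same end terms are equivalent if there is an isomorphism of
the middle terms which is compatible with the identities of the end terms. -/
def ThreeTerm.setoid (X Z : C) : Setoid (ThreeTerm X Z) where
  r s t := ∃ e : s.mid ≅ t.mid, s.i ≫ e.hom = t.i ∧ e.hom ≫ t.p = s.p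
  iseqv :=
    { refl := fun _ => ⟨Iso.refl _, by simp, by simp⟩
      symm := by
        rintro s t ⟨e, h₁, h₂⟩
        exact ⟨e.symm, by simp [← h₁], by simp [← h₂]⟩
      trans := by
        rintro s t r ⟨e, h₁, h₂⟩ ⟨e', h₁', h₂'⟩
        exact ⟨e ≪≫ e', by simp [← h₁', ← h₁], by simp [h₂, h₂']⟩ }

variable (C) in
/-- The data `(𝔼, 𝔰)` of an extriangulated category: a bifunctor `Cᵒᵖ × C ⥤ Ab`, and a
correspondence `𝔰` which sends `δ ∈ 𝔼(Z, X)` to an equivalence class of sequences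
`X ⟶ Y ⟶ Z`. The axioms are in `ExtriData.IsExtriangulated`. -/
structure ExtriData where
  E : Cᵒᵖ ⥤ C ⥤ AddCommGrpCat.{w}
  s : ∀ {Z X : C}, (E.obj (op Z)).obj X → Quotient (ThreeTerm.setoid X Z)

namespace ExtriData

variable (𝔼 : ExtriData.{w} C)

/-- The group `𝔼(Z, X)` of extensions. -/
abbrev Ext (Z X : C) : Type w := (𝔼.E.obj (op Z)).obj X

/-- The map `a_* : 𝔼(Z, X) → 𝔼(Z, X')`. -/
def push {Z X X' : C} (a : X ⟶ X') : 𝔼.Ext Z X →+ 𝔼.Ext Z X' :=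
  ((𝔼.E.obj (op Z)).map a).hom

/-- The map `c^* : 𝔼(Z, X) → 𝔼(Z', X)`. -/
def pull {Z Z' X : C} (c : Z' ⟶ Z) : 𝔼.Ext Z X →+ 𝔼.Ext Z' X :=
  ((𝔼.E.map c.op).app X).hom

/-- `X -x-> Y -y-> Z` together with `δ` is an `𝔼`-triangle: `𝔰(δ) = [X -x-> Y -y-> Z]`. -/
def IsTriangle {X Y Z : C} (x : X ⟶ Y) (y : Y ⟶ Z) (δ : 𝔼.Ext Z X) : Prop :=
  𝔼.s δ = Quotient.mk (ThreeTerm.setoid X Z) ⟨Y, x, y⟩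

variable [Preadditive C] [HasBinaryBiproducts C]

/-- The direct sum `δ ⊕ δ' ∈ 𝔼(Z ⊕ Z', X ⊕ X')` of two extensions. -/
noncomputable def directSum {X X' Z Z' : C} (δ : 𝔼.Ext Z X) (δ' : 𝔼.Ext Z' X') :
    𝔼.Ext (Z ⊞ Z') (X ⊞ X') :=
  𝔼.push biprod.inl (𝔼.pull biprod.fst δ) + 𝔼.push biprod.inr (𝔼.pull biprod.snd δ')

/-- The axioms of an extriangulated category (Nakaoka and Palu). -/
structure IsExtriangulated : Prop where
  /-- (ET1) -/
  additive_left : 𝔼.E.Additive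
  additive_right : ∀ Z : Cᵒᵖ, (𝔼.E.obj Z).Additive
  /-- (ET2), `𝔰` is a realization: morphisms of extensions lift to the middle terms. -/
  realize : ∀ {X Y Z X' Y' Z' : C} {x : X ⟶ Y} {y : Y ⟶ Z} {δ : 𝔼.Ext Z X}
    {x' : X' ⟶ Y'} {y' : Y' ⟶ Z'} {δ' : 𝔼.Ext Z' X'},
    𝔼.IsTriangle x y δ → 𝔼.IsTriangle x' y' δ' →
    ∀ (a : X ⟶ X') (c : Z ⟶ Z'), 𝔼.push a δ = 𝔼.pull c δ' →
      ∃ b : Y ⟶ Y', x ≫ b = a ≫ x' ∧ y ≫ c = b ≫ y'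
  /-- (ET2), the realization is additive. -/
  realize_zero : ∀ X Z : C,
    𝔼.IsTriangle (biprod.inl : X ⟶ X ⊞ Z) (biprod.snd : X ⊞ Z ⟶ Z) 0
  realize_sum : ∀ {X Y Z X' Y' Z' : C} {x : X ⟶ Y} {y : Y ⟶ Z} {δ : 𝔼.Ext Z X}
    {x' : X' ⟶ Y'} {y' : Y' ⟶ Z'} {δ' : 𝔼.Ext Z' X'},
    𝔼.IsTriangle x y δ → 𝔼.IsTriangle x' y' δ' →
    𝔼.IsTriangle (biprod.map x x') (biprod.map y y') (𝔼.directSum δ δ')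
  /-- (ET3) -/
  et3 : ∀ {X Y Z X' Y' Z' : C} {x : X ⟶ Y} {y : Y ⟶ Z} {δ : 𝔼.Ext Z X}
    {x' : X' ⟶ Y'} {y' : Y' ⟶ Z'} {δ' : 𝔼.Ext Z' X'},
    𝔼.IsTriangle x y δ → 𝔼.IsTriangle x' y' δ' →
    ∀ (a : X ⟶ X') (b : Y ⟶ Y'), x ≫ b = a ≫ x' →
      ∃ c : Z ⟶ Z', y ≫ c = b ≫ y' ∧ 𝔼.push a δ = 𝔼.pull c δ'
  /-- (ET3)ᵒᵖ -/
  et3_op : ∀ {X Y Z X' Y' Z' : C} {x : X ⟶ Y} {y : Y ⟶ Z} {δ : 𝔼.Ext Z X}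
    {x' : X' ⟶ Y'} {y' : Y' ⟶ Z'} {δ' : 𝔼.Ext Z' X'},
    𝔼.IsTriangle x y δ → 𝔼.IsTriangle x' y' δ' →
    ∀ (b : Y ⟶ Y') (c : Z ⟶ Z'), y ≫ c = b ≫ y' →
      ∃ a : X ⟶ X', x ≫ b = a ≫ x' ∧ 𝔼.push a δ = 𝔼.pull c δ'
  /-- (ET4): for `𝔼`-triangles `A -f-> B -f'-> D` and `B -g-> B' -g'-> F`, with
  `h = f ≫ g : A ⟶ B'`. -/
  et4 : ∀ {A B D B' F : C} {f : A ⟶ B} {f' : B ⟶ D} {δ : 𝔼.Ext D A}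
    {g : B ⟶ B'} {g' : B' ⟶ F} {δ' : 𝔼.Ext F B},
    𝔼.IsTriangle f f' δ → 𝔼.IsTriangle g g' δ' →
    ∃ (G : C) (h' : B' ⟶ G) (d : D ⟶ G) (e : G ⟶ F) (δ'' : 𝔼.Ext G A),
      𝔼.IsTriangle (f ≫ g) h' δ'' ∧ f' ≫ d = g ≫ h' ∧ h' ≫ e = g' ∧
      𝔼.IsTriangle d e (𝔼.push f' δ') ∧ 𝔼.pull d δ'' = δ ∧
      𝔼.push f δ'' = 𝔼.pull e δ'
  /-- (ET4)ᵒᵖ: for `𝔼`-triangles `D -f'-> A -f-> B` and `F -g'-> B -g-> B'`, with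
  `h = f ≫ g : A ⟶ B'`. -/
  et4_op : ∀ {D A B F B' : C} {f' : D ⟶ A} {f : A ⟶ B} {δ : 𝔼.Ext B D}
    {g' : F ⟶ B} {g : B ⟶ B'} {δ' : 𝔼.Ext B' F},
    𝔼.IsTriangle f' f δ → 𝔼.IsTriangle g' g δ' →
    ∃ (G : C) (h' : G ⟶ A) (d : D ⟶ G) (e : G ⟶ F) (δ'' : 𝔼.Ext B' G),
      𝔼.IsTriangle h' (f ≫ g) δ'' ∧ h' ≫ f = e ≫ g' ∧ d ≫ h' = f' ∧
      𝔼.IsTriangle d e (𝔼.pull g' δ) ∧ 𝔼.push e δ'' = δ' ∧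
      𝔼.push d δ = 𝔼.pull g δ''

end ExtriData

end Extriangulated

section KrullSchmidt

/-- Every object is a finite direct sum of objects with local endomorphism rings. -/
def IsKrullSchmidt (C : Type u) [Category.{v} C] [Preadditive C] [HasFiniteBiproducts C] :
    Prop :=
  ∀ X : C, ∃ (n : ℕ) (F : Fin n → C),
    (∀ i, IsLocalRing (End (F i))) ∧ Nonempty (X ≅ ⨁ F)

/-- A brick: an object whose endomorphism ring is a division ring. -/
def IsBrick {C : Type u} [Category.{v} C] [Preadditive C] (X : C) : Prop :=
  Nontrivial (End X) ∧ ∀ f : End X, f ≠ 0 → IsUnit f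

/-- The set of isomorphism classes of bricks in a subcategory. -/
def brick {C : Type u} [Category.{v} C] [Preadditive C] (P : ObjectProperty C) :
    Set (Quotient (isIsomorphicSetoid C)) :=
  {q | ∃ X : C, IsBrick X ∧ P X ∧ q = Quotient.mk (isIsomorphicSetoid C) X}

end KrullSchmidt

namespace ExtriData

variable {C : Type u} [Category.{v} C] (𝔼 : ExtriData.{w} C) (Θ : C → ℕ)

/-- A length function: a map from isomorphism classes of objects to `ℕ` which vanishes
exactly on zero objects, is subadditive on `𝔼`-triangles and additive on split ones. -/
structure IsLengthFunction : Prop where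
  iso_inv : ∀ {X Y : C}, (X ≅ Y) → Θ X = Θ Y
  eq_zero_iff : ∀ X : C, Θ X = 0 ↔ IsZero X
  le_add : ∀ {X Y Z : C} {x : X ⟶ Y} {y : Y ⟶ Z} {δ : 𝔼.Ext Z X},
    𝔼.IsTriangle x y δ → Θ Y ≤ Θ X + Θ Z
  eq_add_of_split : ∀ {X Y Z : C} {x : X ⟶ Y} {y : Y ⟶ Z},
    𝔼.IsTriangle x y 0 → Θ Y = Θ X + Θ Z

/-- A `Θ`-stable `𝔼`-triangle. -/
def IsStableTriangle {X Y Z : C} (x : X ⟶ Y) (y : Y ⟶ Z) (δ : 𝔼.Ext Z X) : Prop :=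
  𝔼.IsTriangle x y δ ∧ Θ Y = Θ X + Θ Z

/-- A `Θ`-inflation. -/
def IsInflation {X Y : C} (x : X ⟶ Y) : Prop :=
  ∃ (Z : C) (y : Y ⟶ Z) (δ : 𝔼.Ext Z X), 𝔼.IsStableTriangle Θ x y δ

/-- A `Θ`-deflation. -/
def IsDeflation {Y Z : C} (y : Y ⟶ Z) : Prop :=
  ∃ (X : C) (x : X ⟶ Y) (δ : 𝔼.Ext Z X), 𝔼.IsStableTriangle Θ x y δ

/-- A `Θ`-admissible morphism: a `Θ`-deflation followed by a `Θ`-inflation. -/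
def IsAdmissible {M N : C} (f : M ⟶ N) : Prop :=
  ∃ (X : C) (i : M ⟶ X) (j : X ⟶ N),
    𝔼.IsDeflation Θ i ∧ 𝔼.IsInflation Θ j ∧ i ≫ j = f

/-- An extriangulated length category: `Θ` is a length function and every morphism is
`Θ`-admissible. -/
structure IsLengthCategory [Preadditive C] [HasBinaryBiproducts C] : Prop where
  extriangulated : 𝔼.IsExtriangulated
  lengthFunction : 𝔼.IsLengthFunction Θ
  admissible : ∀ {M N : C} (f : M ⟶ N), 𝔼.IsAdmissible Θ f

/-- `Fac_Θ(P)`: targets of `Θ`-deflations from objects of `P`. -/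
def Fac (P : ObjectProperty C) : ObjectProperty C :=
  fun M => ∃ (S : C) (y : S ⟶ M), P S ∧ 𝔼.IsDeflation Θ y

/-- `Sub_Θ(P)`: sources of `Θ`-inflations to objects of `P`. -/
def Sub (P : ObjectProperty C) : ObjectProperty C :=
  fun M => ∃ (S : C) (x : M ⟶ S), P S ∧ 𝔼.IsInflation Θ x

/-- `P *_Θ Q`: middle terms of stable `𝔼`-triangles with end terms in `P` and `Q`. -/
def star (P Q : ObjectProperty C) : ObjectProperty C :=
  fun M => ∃ (T F : C) (x : T ⟶ M) (y : M ⟶ F) (δ : 𝔼.Ext F T),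
    P T ∧ Q F ∧ 𝔼.IsStableTriangle Θ x y δ

/-- A torsion class: a (non-empty, isomorphism-closed, full) subcategory which is closed
under `Θ`-quotients and `Θ`-stable extensions. -/
structure IsTorsionClass (T : ObjectProperty C) : Prop where
  nonempty : ∃ X, T X
  isoClosed : T.IsClosedUnderIsomorphisms
  fac_le : 𝔼.Fac Θ T ≤ T
  star_le : 𝔼.star Θ T T ≤ T

/-- The poset of torsion classes, ordered by inclusion. -/
abbrev Tors : Type u :=
  {T : ObjectProperty C // 𝔼.IsTorsionClass Θ T}

/-- `T_Θ(P)`: the intersection of all torsion classes which contain `P`. -/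
def torsionClosure (P : ObjectProperty C) : ObjectProperty C :=
  fun M => ∀ T : ObjectProperty C, 𝔼.IsTorsionClass Θ T → P ≤ T → T M

end ExtriData

end ExtriLength

/-!
For a torsion class `U`, every object is a stable extension of an object of `U^⊥` by an object
of `U`, so an object of `T` outside `U` has a nonzero `Θ`-quotient in `U^⊥ ∩ T`. If `S` is a nonzero
object of minimal length in `U^⊥ ∩ T`, the image of a nonzero morphism from an object of `T` to `S`
is again a nonzero object of `U^⊥ ∩ T`, so the morphism is a deflation; applied to endomorphisms,
this makes `S` a brick. Hence a proper inclusion of torsion classes always produces a brick, and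
`U < V < T` produces two non-isomorphic ones.

Suppose now that `T` covers `U`, and let `F` and `X` be nonzero in `U^⊥ ∩ T`. The objects of `T`
without nonzero morphisms to `U^⊥ ∩ (Fac F)^⊥` form a torsion class containing `U` and `F`, hence
equal to `T`, so `X` is one of them. As `X` is nonzero, it is not in `(Fac F)^⊥`, i.e. some quotient
of `F` has a nonzero morphism to `X`. Taking `X = S` shows that `S` is a quotient of `F`, and taking
`F = S` shows that `S` is a subobject of `X`.
-/

namespace ExtriLength

section Order

variable {α : Type*} [PartialOrder α] {a b : α}

theorem encard_Icc_eq_one_iff : (Set.Icc a b).encard = 1 ↔ a = b := by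
  simp only [Set.encard_eq_one, Set.Icc_eq_singleton_iff, exists_eq_left']
  exact eq_comm

theorem encard_Icc_eq_two_iff_covBy : (Set.Icc a b).encard = 2 ↔ a ⋖ b := by
  refine ⟨fun hcard => ?_, fun hab => by rw [hab.Icc_eq, Set.encard_pair hab.ne]⟩
  have hne : a ≠ b := fun hab => by
    rw [encard_Icc_eq_one_iff.2 hab] at hcard
    norm_num at hcard
  have hle : a ≤ b := Set.nonempty_Icc.1 (Set.encard_ne_zero.1 (by simp [hcard]))
  have hpair : {a, b} = Set.Icc a b :=
    (Set.toFinite {a, b}).eq_of_subset_of_encard_le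
      (Set.pair_subset (Set.left_mem_Icc.2 hle) (Set.right_mem_Icc.2 hle))
      (by rw [hcard, Set.encard_pair hne])
  refine ⟨hle.lt_of_ne hne, fun c hac hcb => ?_⟩
  obtain rfl | rfl : c ∈ ({a, b} : Set α) := hpair ▸ ⟨hac.le, hcb.le⟩
  exacts [hac.false, hcb.false]

end Order

section Category

variable {C : Type u} [Category.{v} C]

-- The square is needed: as `i` and `j` need not be epi or mono, `j ≫ i` need not be idempotent.
theorem comp_cube_eq_sq_of_comp_sq_eq {K J : C} {i : K ⟶ J} {j : J ⟶ K}
    (hij : (i ≫ j) ≫ i ≫ j = i ≫ j) :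
    (j ≫ i) ≫ (j ≫ i) ≫ j ≫ i = (j ≫ i) ≫ j ≫ i := by
  simpa using congrArg (fun f => j ≫ f ≫ i) hij

theorem exists_splitting_of_comp {K J L : C} {i : K ⟶ J} {j : J ⟶ K}
    (hij : (i ≫ j) ≫ i ≫ j = i ≫ j) {b : L ⟶ J} {a : J ⟶ L} (hba : b ≫ a = 𝟙 L)
    (hab : a ≫ b = (j ≫ i) ≫ j ≫ i) :
    ∃ (b' : L ⟶ K) (a' : K ⟶ L), b' ≫ a' = 𝟙 L ∧ a' ≫ b' = i ≫ j := by
  have hcube := comp_cube_eq_sq_of_comp_sq_eq hij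
  have hb : b ≫ (j ≫ i) ≫ j ≫ i = b := by rw [← hab, reassoc_of% hba]
  refine ⟨b ≫ j, i ≫ a, ?_, ?_⟩
  · calc (b ≫ j) ≫ i ≫ a = (b ≫ (j ≫ i) ≫ j ≫ i) ≫ (j ≫ i) ≫ a := by rw [hb]; simp
      _ = b ≫ ((j ≫ i) ≫ (j ≫ i) ≫ j ≫ i) ≫ a := by simp
      _ = b ≫ a := by rw [hcube, ← Category.assoc, hb]
      _ = 𝟙 L := hba
  · calc (i ≫ a) ≫ b ≫ j = i ≫ (a ≫ b) ≫ j := by simp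
      _ = (i ≫ j) ≫ (i ≫ j) ≫ i ≫ j := by rw [hab]; simp
      _ = i ≫ j := by rw [hij, hij]

theorem isZero_of_rightOrthogonal [HasZeroMorphisms C] {P : ObjectProperty C} {X : C}
    (hX : P.rightOrthogonal X) (hPX : P X) : IsZero X :=
  (IsZero.iff_id_eq_zero X).2 (hX (𝟙 X) hPX)

variable [Preadditive C]

theorem exists_iso_biprod_of_retract [HasBinaryBiproducts C] [IsIdempotentComplete C] {Y K : C}
    (r : Retract Y K) : ∃ L : C, Nonempty (K ≅ Y ⊞ L) := by
  obtain ⟨L, b, a, hba, hab⟩ :=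
    IsIdempotentComplete.idempotents_split K (𝟙 K - r.r ≫ r.i) (by simp)
  have hia : r.i ≫ a = 0 := by
    calc r.i ≫ a = r.i ≫ (a ≫ b) ≫ a := by simp [hba]
      _ = 0 := by simp [hab]
  have hbr : b ≫ r.r = 0 := by
    calc b ≫ r.r = b ≫ (a ≫ b) ≫ r.r := by simp [reassoc_of% hba]
      _ = 0 := by simp [hab]
  exact ⟨L, ⟨{
    hom := biprod.lift r.r a
    inv := biprod.desc r.i b
    hom_inv_id := by simp [hab]
    inv_hom_id := by ext <;> simp [hia, hbr, hba] }⟩⟩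

theorem IsBrick.not_isZero {S : C} (hS : IsBrick S) : ¬ IsZero S := by
  intro hz
  have := hS.1
  exact one_ne_zero (α := End S) (hz.eq_of_src _ _)

theorem IsBrick.notMem_of_rightOrthogonal {S : C} (hS : IsBrick S) {P : ObjectProperty C}
    (hPS : P.rightOrthogonal S) : ¬ P S :=
  fun hmem => hS.not_isZero (isZero_of_rightOrthogonal hPS hmem)

end Category

/-- A nonzero object of minimal length in a subcategory. For torsion classes `U` and `T`, those in
`U^⊥ ∩ T` are the bricks of minimal length. -/
structure IsShortest {C : Type u} [Category.{v} C] (Θ : C → ℕ) (P : ObjectProperty C) (S : C) :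
    Prop where
  mem : P S
  not_isZero : ¬ IsZero S
  length_le : ∀ X, P X → ¬ IsZero X → Θ S ≤ Θ X

theorem exists_isShortest {C : Type u} [Category.{v} C] (Θ : C → ℕ) {P : ObjectProperty C}
    (hP : ∃ X, P X ∧ ¬ IsZero X) : ∃ S, IsShortest Θ P S := by
  obtain ⟨S, hS⟩ := exists_minimalFor_of_wellFoundedLT (fun X => P X ∧ ¬ IsZero X) Θ hP
  exact ⟨S, hS.1.1, hS.1.2, fun X hX hX0 => hS.le ⟨hX, hX0⟩⟩

namespace ExtriData

variable {C : Type u} [Category.{v} C] {𝔼 : ExtriData.{w} C} {Θ : C → ℕ}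

/-! ### `𝔼`-triangles -/

theorem IsTriangle.of_iso {X Y Y' Z : C} {x : X ⟶ Y} {y : Y ⟶ Z} {δ : 𝔼.Ext Z X}
    (hδ : 𝔼.IsTriangle x y δ) (e : Y ≅ Y') {x' : X ⟶ Y'} {y' : Y' ⟶ Z}
    (hx : x ≫ e.hom = x') (hy : e.hom ≫ y' = y) : 𝔼.IsTriangle x' y' δ :=
  Eq.trans hδ (Quotient.sound ⟨e, hx, hy⟩)

theorem IsTriangle.exists_iso {X Y Y' Z : C} {x : X ⟶ Y} {y : Y ⟶ Z} {δ : 𝔼.Ext Z X}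
    {x' : X ⟶ Y'} {y' : Y' ⟶ Z} (hδ : 𝔼.IsTriangle x y δ) (hδ' : 𝔼.IsTriangle x' y' δ) :
    ∃ e : Y ≅ Y', x ≫ e.hom = x' ∧ e.hom ≫ y' = y :=
  Quotient.exact (Eq.trans (Eq.symm hδ) hδ')

theorem IsInflation.length_le {X Y : C} {f : X ⟶ Y} (hf : 𝔼.IsInflation Θ f) : Θ X ≤ Θ Y := by
  obtain ⟨_, _, _, _, hΘ⟩ := hf
  omega

theorem IsDeflation.length_le {X Y : C} {f : X ⟶ Y} (hf : 𝔼.IsDeflation Θ f) : Θ Y ≤ Θ X := by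
  obtain ⟨_, _, _, _, hΘ⟩ := hf
  omega

theorem fac_singleton_iff {X M : C} :
    𝔼.Fac Θ (ObjectProperty.singleton X) M ↔ ∃ f : X ⟶ M, 𝔼.IsDeflation Θ f := by
  simp only [Fac, ObjectProperty.singleton_iff]
  exact ⟨fun ⟨_, f, hX, hf⟩ => by subst hX; exact ⟨f, hf⟩, fun ⟨f, hf⟩ => ⟨X, f, rfl, hf⟩⟩

theorem sub_singleton_iff {X M : C} :
    𝔼.Sub Θ (ObjectProperty.singleton X) M ↔ ∃ f : M ⟶ X, 𝔼.IsInflation Θ f := by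
  simp only [Sub, ObjectProperty.singleton_iff]
  exact ⟨fun ⟨_, f, hX, hf⟩ => by subst hX; exact ⟨f, hf⟩, fun ⟨f, hf⟩ => ⟨X, f, rfl, hf⟩⟩

theorem le_torsionClosure (P : ObjectProperty C) : P ≤ 𝔼.torsionClosure Θ P :=
  fun _ hX _ _ hPT => hPT _ hX

theorem torsionClosure_le {P T : ObjectProperty C} (hT : 𝔼.IsTorsionClass Θ T) (hPT : P ≤ T) :
    𝔼.torsionClosure Θ P ≤ T :=
  fun _ hX => hX T hT hPT

theorem isTorsionClass_torsionClosure {P : ObjectProperty C} (hP : ∃ X, P X) :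
    𝔼.IsTorsionClass Θ (𝔼.torsionClosure Θ P) where
  nonempty := hP.imp (le_torsionClosure P)
  isoClosed := ⟨fun e hX T hT hPT => hT.isoClosed.of_iso e (hX T hT hPT)⟩
  fac_le := by
    rintro M ⟨N, y, hN, hy⟩ T hT hPT
    exact hT.fac_le _ ⟨N, y, hN T hT hPT, hy⟩
  star_le := by
    rintro M ⟨X, Z, x, y, δ, hX, hZ, hδ⟩ T hT hPT
    exact hT.star_le _ ⟨X, Z, x, y, δ, hX T hT hPT, hZ T hT hPT, hδ⟩

theorem eq_torsionClosure_of_covBy {U T : 𝔼.Tors Θ} (hUT : U ⋖ T) {X : C} (hX : T.1 X)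
    (hXU : ¬ U.1 X) : T.1 = 𝔼.torsionClosure Θ (U.1 ⊔ ObjectProperty.singleton X) := by
  let P := U.1 ⊔ ObjectProperty.singleton X
  have hXP : P X := Or.inr ((ObjectProperty.singleton_iff X X).2 rfl)
  let V : 𝔼.Tors Θ := ⟨𝔼.torsionClosure Θ P, isTorsionClass_torsionClosure ⟨X, hXP⟩⟩
  have hPV : P ≤ V.1 := le_torsionClosure P
  have hUV : U ≤ V := le_sup_left.trans hPV
  have hVT : V ≤ T :=
    torsionClosure_le T.2 (sup_le hUT.le (ObjectProperty.singleton_le_iff.2 hX))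
  have hVne : V ≠ U := fun hVU => hXU (hVU ▸ hPV X hXP)
  exact congrArg Subtype.val ((hUT.eq_or_eq hUV hVT).resolve_left hVne).symm

theorem IsTorsionClass.inf {T T' : ObjectProperty C} (hT : 𝔼.IsTorsionClass Θ T)
    (hT' : 𝔼.IsTorsionClass Θ T') (hne : ∃ X, (T ⊓ T') X) : 𝔼.IsTorsionClass Θ (T ⊓ T') where
  nonempty := hne
  isoClosed := ⟨fun e hX => ⟨hT.isoClosed.of_iso e hX.1, hT'.isoClosed.of_iso e hX.2⟩⟩
  fac_le := by
    rintro M ⟨N, y, hN, hy⟩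
    exact ⟨hT.fac_le _ ⟨N, y, hN.1, hy⟩, hT'.fac_le _ ⟨N, y, hN.2, hy⟩⟩
  star_le := by
    rintro M ⟨X, Z, x, y, δ, hX, hZ, hδ⟩
    exact ⟨hT.star_le _ ⟨X, Z, x, y, δ, hX.1, hZ.1, hδ⟩,
      hT'.star_le _ ⟨X, Z, x, y, δ, hX.2, hZ.2, hδ⟩⟩

variable [Preadditive C] [HasBinaryBiproducts C]

namespace IsExtriangulated

variable (hE : 𝔼.IsExtriangulated)
include hE

theorem ext_eq_zero_of_isZero_left {Z X : C} (hZ : IsZero Z) (δ : 𝔼.Ext Z X) : δ = 0 := by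
  have := hE.additive_left
  have hid : 𝔼.pull (𝟙 Z) δ = δ := by simp [pull]
  have hzero : 𝔼.pull (0 : Z ⟶ Z) δ = 0 := by simp [pull]
  rw [← hid, hZ.eq_of_src (𝟙 Z) 0, hzero]

theorem ext_eq_zero_of_isZero_right {Z X : C} (hX : IsZero X) (δ : 𝔼.Ext Z X) : δ = 0 := by
  have := hE.additive_right (op Z)
  have hid : 𝔼.push (𝟙 X) δ = δ := by simp [push]
  have hzero : 𝔼.push (0 : X ⟶ X) δ = 0 := by simp [push]
  rw [← hid, hX.eq_of_src (𝟙 X) 0, hzero]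

theorem isTriangle_iso_zero {X Y Z : C} (e : X ≅ Y) (hZ : IsZero Z) :
    𝔼.IsTriangle e.hom (0 : Y ⟶ Z) 0 :=
  (hE.realize_zero X Z).of_iso ((isoBiprodZero hZ).symm ≪≫ e) (by simp) (hZ.eq_of_tgt _ _)

theorem isTriangle_zero_iso {X Y Z : C} (e : Y ≅ Z) (hX : IsZero X) :
    𝔼.IsTriangle (0 : X ⟶ Y) e.hom 0 :=
  (hE.realize_zero X Z).of_iso ((isoZeroBiprod hX).symm ≪≫ e.symm) (hX.eq_of_src _ _) (by simp)

theorem isIso_of_isZero_right {X Y Z : C} {x : X ⟶ Y} {y : Y ⟶ Z} {δ : 𝔼.Ext Z X}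
    (hδ : 𝔼.IsTriangle x y δ) (hZ : IsZero Z) : IsIso x := by
  rw [hE.ext_eq_zero_of_isZero_left hZ δ] at hδ
  obtain ⟨e, he, -⟩ := (hE.isTriangle_iso_zero (Iso.refl X) hZ).exists_iso hδ
  rw [← he]
  infer_instance

theorem isIso_of_isZero_left {X Y Z : C} {x : X ⟶ Y} {y : Y ⟶ Z} {δ : 𝔼.Ext Z X}
    (hδ : 𝔼.IsTriangle x y δ) (hX : IsZero X) : IsIso y := by
  rw [hE.ext_eq_zero_of_isZero_right hX δ] at hδ
  obtain ⟨e, -, he⟩ := hδ.exists_iso (hE.isTriangle_zero_iso (Iso.refl Z) hX)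
  rw [← he]
  infer_instance

variable [HasZeroObject C]

open ZeroObject

theorem exists_desc {X Y Z W : C} {x : X ⟶ Y} {y : Y ⟶ Z} {δ : 𝔼.Ext Z X}
    (hδ : 𝔼.IsTriangle x y δ) (f : Y ⟶ W) (hf : x ≫ f = 0) : ∃ g : Z ⟶ W, y ≫ g = f := by
  obtain ⟨g, hg, -⟩ := hE.et3 hδ (hE.isTriangle_zero_iso (Iso.refl W) (isZero_zero C)) 0 f
    (by simp [hf])
  exact ⟨g, by simpa using hg⟩

theorem exists_lift {X Y Z W : C} {x : X ⟶ Y} {y : Y ⟶ Z} {δ : 𝔼.Ext Z X}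
    (hδ : 𝔼.IsTriangle x y δ) (f : W ⟶ Y) (hf : f ≫ y = 0) : ∃ g : W ⟶ X, g ≫ x = f := by
  obtain ⟨g, hg, -⟩ := hE.et3_op (hE.isTriangle_iso_zero (Iso.refl W) (isZero_zero C)) hδ f 0
    (by simp [hf])
  exact ⟨g, by simpa using hg.symm⟩

end IsExtriangulated

/-! ### Length functions -/

namespace IsLengthFunction

variable (hΘ : 𝔼.IsLengthFunction Θ) (hE : 𝔼.IsExtriangulated)
include hΘ hE

theorem isStableTriangle_iso_zero {X Y Z : C} (e : X ≅ Y) (hZ : IsZero Z) :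
    𝔼.IsStableTriangle Θ e.hom (0 : Y ⟶ Z) 0 :=
  have hδ := hE.isTriangle_iso_zero e hZ
  ⟨hδ, hΘ.eq_add_of_split hδ⟩

theorem isStableTriangle_zero_iso {X Y Z : C} (e : Y ≅ Z) (hX : IsZero X) :
    𝔼.IsStableTriangle Θ (0 : X ⟶ Y) e.hom 0 :=
  have hδ := hE.isTriangle_zero_iso e hX
  ⟨hδ, hΘ.eq_add_of_split hδ⟩

theorem isInflation_of_iso [HasZeroObject C] {X Y : C} (e : X ≅ Y) : 𝔼.IsInflation Θ e.hom :=
  ⟨_, _, _, hΘ.isStableTriangle_iso_zero hE e (isZero_zero C)⟩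

theorem isDeflation_of_iso [HasZeroObject C] {X Y : C} (e : X ≅ Y) : 𝔼.IsDeflation Θ e.hom :=
  ⟨_, _, _, hΘ.isStableTriangle_zero_iso hE e (isZero_zero C)⟩

theorem isDeflation_zero {X Z : C} (hZ : IsZero Z) : 𝔼.IsDeflation Θ (0 : X ⟶ Z) :=
  ⟨_, _, _, hΘ.isStableTriangle_iso_zero hE (Iso.refl X) hZ⟩

theorem isIso_of_isInflation {X Y : C} {f : X ⟶ Y} (hf : 𝔼.IsInflation Θ f)
    (hle : Θ Y ≤ Θ X) : IsIso f := by
  obtain ⟨Z, _, _, hδ, hadd⟩ := hf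
  exact hE.isIso_of_isZero_right hδ ((hΘ.eq_zero_iff Z).1 (by omega))

theorem isIso_of_isDeflation {X Y : C} {f : X ⟶ Y} (hf : 𝔼.IsDeflation Θ f)
    (hle : Θ X ≤ Θ Y) : IsIso f := by
  obtain ⟨Z, _, _, hδ, hadd⟩ := hf
  exact hE.isIso_of_isZero_left hδ ((hΘ.eq_zero_iff Z).1 (by omega))

theorem isInflation_comp {X Y Z : C} {f : X ⟶ Y} {g : Y ⟶ Z} (hf : 𝔼.IsInflation Θ f)
    (hg : 𝔼.IsInflation Θ g) : 𝔼.IsInflation Θ (f ≫ g) := by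
  obtain ⟨_, _, _, hδ, hadd⟩ := hf
  obtain ⟨_, _, _, hδ', hadd'⟩ := hg
  obtain ⟨G, p, _, _, ε, hp, -, -, hG, -, -⟩ := hE.et4 hδ hδ'
  have := hΘ.le_add hp
  have := hΘ.le_add hG
  exact ⟨G, p, ε, hp, by omega⟩

theorem exists_preimage {X Y Z Q I : C} {x : X ⟶ Y} {y : Y ⟶ Z} {δ : 𝔼.Ext Z X}
    (hδ : 𝔼.IsStableTriangle Θ x y δ) {j : I ⟶ Z} {q : Z ⟶ Q} {δ' : 𝔼.Ext Q I}
    (hδ' : 𝔼.IsStableTriangle Θ j q δ') :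
    ∃ (G : C) (k : G ⟶ Y) (d : X ⟶ G) (e : G ⟶ I) (ε : 𝔼.Ext Q G) (ε' : 𝔼.Ext I X),
      𝔼.IsStableTriangle Θ k (y ≫ q) ε ∧ 𝔼.IsStableTriangle Θ d e ε' := by
  obtain ⟨G, k, d, e, ε, hk, -, -, hd, -, -⟩ := hE.et4_op hδ.1 hδ'.1
  have := hΘ.le_add hk
  have := hΘ.le_add hd
  have := hδ.2
  have := hδ'.2
  exact ⟨G, k, d, e, ε, _, ⟨hk, by omega⟩, ⟨hd, by omega⟩⟩

theorem isDeflation_comp {X Y Z : C} {f : X ⟶ Y} {g : Y ⟶ Z} (hf : 𝔼.IsDeflation Θ f)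
    (hg : 𝔼.IsDeflation Θ g) : 𝔼.IsDeflation Θ (f ≫ g) := by
  obtain ⟨_, _, _, hδ⟩ := hf
  obtain ⟨_, _, _, hδ'⟩ := hg
  obtain ⟨G, k, -, -, ε, -, hk, -⟩ := hΘ.exists_preimage hE hδ hδ'
  exact ⟨G, k, ε, hk⟩

theorem length_biprod (X Y : C) : Θ (X ⊞ Y) = Θ X + Θ Y :=
  hΘ.eq_add_of_split (hE.realize_zero X Y)

theorem length_le_of_retract [IsIdempotentComplete C] {Y K : C} (r : Retract Y K) :
    Θ Y ≤ Θ K := by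
  obtain ⟨L, ⟨e⟩⟩ := exists_iso_biprod_of_retract r
  rw [hΘ.iso_inv e, hΘ.length_biprod hE]
  exact Nat.le_add_right _ _

theorem isZero_of_isDeflation_zero [HasZeroObject C] [IsIdempotentComplete C] {Y Q : C}
    (hy : 𝔼.IsDeflation Θ (0 : Y ⟶ Q)) : IsZero Q := by
  obtain ⟨K, x, δ, hδ, hadd⟩ := hy
  obtain ⟨s, hs⟩ := hE.exists_lift hδ (𝟙 Y) comp_zero
  have := hΘ.length_le_of_retract hE ⟨s, x, hs⟩
  exact (hΘ.eq_zero_iff Q).1 (by omega)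

theorem isZero_of_isInflation_zero [HasZeroObject C] [IsIdempotentComplete C] {X Y : C}
    (hx : 𝔼.IsInflation Θ (0 : X ⟶ Y)) : IsZero X := by
  obtain ⟨Q, y, δ, hδ, hadd⟩ := hx
  obtain ⟨r, hr⟩ := hE.exists_desc hδ (𝟙 Y) zero_comp
  have := hΘ.length_le_of_retract hE ⟨y, r, hr⟩
  exact (hΘ.eq_zero_iff X).1 (by omega)

theorem fac_fac_le (P : ObjectProperty C) : 𝔼.Fac Θ (𝔼.Fac Θ P) ≤ 𝔼.Fac Θ P := by
  rintro M ⟨N, y, ⟨L, z, hL, hz⟩, hy⟩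
  exact ⟨L, z ≫ y, hL, hΘ.isDeflation_comp hE hz hy⟩

end IsLengthFunction

theorem IsTorsionClass.mem_of_isZero {T : ObjectProperty C} (hT : 𝔼.IsTorsionClass Θ T)
    (hΘ : 𝔼.IsLengthFunction Θ) (hE : 𝔼.IsExtriangulated) {Z : C} (hZ : IsZero Z) : T Z := by
  obtain ⟨X, hX⟩ := hT.nonempty
  exact hT.fac_le _ ⟨X, 0, hX, hΘ.isDeflation_zero hE hZ⟩

/-! ### Torsion pairs in length categories -/

namespace IsLengthCategory

variable (h : 𝔼.IsLengthCategory Θ)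
include h

theorem isIdempotentComplete : IsIdempotentComplete C where
  idempotents_split K f hf := by
    induction hn : Θ K using Nat.strong_induction_on generalizing K with
    | _ n ih =>
      obtain ⟨J, i, j, hi, hj, rfl⟩ := h.admissible f
      rcases hi.length_le.lt_or_eq with hlt | heq
      · have hsq : ((j ≫ i) ≫ j ≫ i) ≫ (j ≫ i) ≫ j ≫ i = (j ≫ i) ≫ j ≫ i := by
          have hcube := comp_cube_eq_sq_of_comp_sq_eq hf
          rw [Category.assoc, hcube, hcube]
        obtain ⟨L, b, a, hba, hab⟩ := ih (Θ J) (by omega) J _ hsq rfl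
        exact ⟨L, exists_splitting_of_comp hf hba hab⟩
      · have := h.lengthFunction.isIso_of_isDeflation h.extriangulated hi heq.ge
        have := h.lengthFunction.isIso_of_isInflation h.extriangulated hj heq.ge
        exact ⟨K, 𝟙 K, 𝟙 K, by simp, (cancel_epi (i ≫ j)).1 (by simpa using hf.symm)⟩

theorem admissible_of_ne_zero {M N : C} {f : M ⟶ N} (hf : f ≠ 0) :
    ∃ (J : C) (i : M ⟶ J) (j : J ⟶ N),
      𝔼.IsDeflation Θ i ∧ 𝔼.IsInflation Θ j ∧ i ≫ j = f ∧ ¬ IsZero J := by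
  obtain ⟨J, i, j, hi, hj, rfl⟩ := h.admissible f
  exact ⟨J, i, j, hi, hj, rfl, fun hJ => hf (by rw [hJ.eq_of_tgt i 0, zero_comp])⟩

variable [HasZeroObject C]

open ZeroObject

theorem sub_rightOrthogonal_le {P : ObjectProperty C} (hP : 𝔼.Fac Θ P ≤ P) :
    𝔼.Sub Θ P.rightOrthogonal ≤ P.rightOrthogonal := by
  rintro M ⟨N, x, hN, hx⟩ Y f hY
  have := h.isIdempotentComplete
  by_contra hf
  obtain ⟨J, i, j, hi, hj, -, hJ⟩ := h.admissible_of_ne_zero hf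
  have hjx := h.lengthFunction.isInflation_comp h.extriangulated hj hx
  rw [hN (j ≫ x) (hP _ ⟨Y, i, hY, hi⟩)] at hjx
  exact hJ (h.lengthFunction.isZero_of_isInflation_zero h.extriangulated hjx)

theorem fac_leftOrthogonal_le {Q : ObjectProperty C} (hQ : 𝔼.Sub Θ Q ≤ Q) :
    𝔼.Fac Θ Q.leftOrthogonal ≤ Q.leftOrthogonal := by
  rintro N ⟨M, y, hM, hy⟩ Y f hY
  have := h.isIdempotentComplete
  by_contra hf
  obtain ⟨J, i, j, hi, hj, -, hJ⟩ := h.admissible_of_ne_zero hf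
  have hyi := h.lengthFunction.isDeflation_comp h.extriangulated hy hi
  rw [hM (y ≫ i) (hQ _ ⟨Y, j, hY, hj⟩)] at hyi
  exact hJ (h.lengthFunction.isZero_of_isDeflation_zero h.extriangulated hyi)

theorem isTorsionClass_leftOrthogonal {Q : ObjectProperty C} (hQ : 𝔼.Sub Θ Q ≤ Q) :
    𝔼.IsTorsionClass Θ Q.leftOrthogonal where
  nonempty := ⟨0, fun _ _ _ => (isZero_zero C).eq_of_src _ _⟩
  isoClosed := inferInstance
  fac_le := h.fac_leftOrthogonal_le hQ
  star_le := by
    rintro M ⟨X, Z, x, y, δ, hX, hZ, hδ, -⟩ Y f hY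
    obtain ⟨g, rfl⟩ := h.extriangulated.exists_desc hδ f (hX _ hY)
    rw [hZ g hY, comp_zero]

theorem star_rightOrthogonal {T : ObjectProperty C} (hT : 𝔼.IsTorsionClass Θ T) (M : C) :
    𝔼.star Θ T T.rightOrthogonal M := by
  have hE := h.extriangulated
  have hΘ := h.lengthFunction
  -- Among the quotients of `M` by subobjects in `T`, a shortest one is torsion-free.
  obtain ⟨F, ⟨X, x, y, δ, hX, hδ⟩, hmin⟩ := exists_minimalFor_of_wellFoundedLT
    (fun F => ∃ (X : C) (x : X ⟶ M) (y : M ⟶ F) (δ : 𝔼.Ext F X),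
      T X ∧ 𝔼.IsStableTriangle Θ x y δ) Θ
    ⟨M, 0, _, _, _, hT.mem_of_isZero hΘ hE (isZero_zero C),
      hΘ.isStableTriangle_zero_iso hE (Iso.refl M) (isZero_zero C)⟩
  refine ⟨X, F, x, y, δ, hX, fun Y f hY => ?_, hδ⟩
  by_contra hf
  obtain ⟨I, i, j, hi, ⟨Q, q, δ', hj⟩, -, hI⟩ := h.admissible_of_ne_zero hf
  obtain ⟨G, k, d, e, ε, ε', hk, hd⟩ := hΘ.exists_preimage hE hδ hj
  have hG : T G := hT.star_le _ ⟨X, I, d, e, ε', hX, hT.fac_le _ ⟨Y, i, hY, hi⟩, hd⟩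
  have hadd : Θ F = Θ I + Θ Q := hj.2
  have hle : Θ F ≤ Θ Q := hmin ⟨G, k, _, ε, hG, hk⟩ (by omega)
  exact hI ((hΘ.eq_zero_iff I).1 (by omega))

theorem exists_isDeflation_of_notMem {U T : ObjectProperty C} (hU : 𝔼.IsTorsionClass Θ U)
    (hT : 𝔼.Fac Θ T ≤ T) {M : C} (hM : T M) (hMU : ¬ U M) :
    ∃ (F : C) (y : M ⟶ F), 𝔼.IsDeflation Θ y ∧ (U.rightOrthogonal ⊓ T) F ∧ ¬ IsZero F := by
  obtain ⟨X, F, x, y, δ, hX, hF, hδ⟩ := h.star_rightOrthogonal hU M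
  refine ⟨F, y, ⟨X, x, δ, hδ⟩, ⟨hF, hT _ ⟨M, y, hM, X, x, δ, hδ⟩⟩, fun hz => hMU ?_⟩
  have := h.extriangulated.isIso_of_isZero_right hδ.1 hz
  exact hU.isoClosed.of_iso (asIso x) hX

/-! ### Shortest objects and bricks -/

theorem exists_isShortest_of_not_le {U T : ObjectProperty C} (hU : 𝔼.IsTorsionClass Θ U)
    (hT : 𝔼.Fac Θ T ≤ T) (hTU : ¬ T ≤ U) : ∃ S, IsShortest Θ (U.rightOrthogonal ⊓ T) S := by
  obtain ⟨M, hM, hMU⟩ : ∃ M, T M ∧ ¬ U M := by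
    by_contra! hall
    exact hTU hall
  obtain ⟨F, -, -, hF, hF0⟩ := h.exists_isDeflation_of_notMem hU hT hM hMU
  exact exists_isShortest Θ ⟨F, hF, hF0⟩

theorem isDeflation_of_isShortest {U T : ObjectProperty C} (hU : 𝔼.Fac Θ U ≤ U)
    (hT : 𝔼.Fac Θ T ≤ T) {S X : C} (hS : IsShortest Θ (U.rightOrthogonal ⊓ T) S) (hX : T X)
    {f : X ⟶ S} (hf : f ≠ 0) : 𝔼.IsDeflation Θ f := by
  have hE := h.extriangulated
  have hΘ := h.lengthFunction
  obtain ⟨J, i, j, hi, hj, rfl, hJ0⟩ := h.admissible_of_ne_zero hf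
  have hJ : (U.rightOrthogonal ⊓ T) J :=
    ⟨h.sub_rightOrthogonal_le hU _ ⟨S, j, hS.mem.1, hj⟩, hT _ ⟨X, i, hX, hi⟩⟩
  have := hΘ.isIso_of_isInflation hE hj (hS.length_le J hJ hJ0)
  exact hΘ.isDeflation_comp hE hi (hΘ.isDeflation_of_iso hE (asIso j))

theorem isBrick_of_isShortest {U T : ObjectProperty C} (hU : 𝔼.Fac Θ U ≤ U)
    (hT : 𝔼.Fac Θ T ≤ T) {S : C} (hS : IsShortest Θ (U.rightOrthogonal ⊓ T) S) :
    IsBrick S := by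
  refine ⟨⟨1, 0, fun h1 => hS.not_isZero ((IsZero.iff_id_eq_zero S).2 h1)⟩, fun f hf => ?_⟩
  have : IsIso (f : S ⟶ S) := h.lengthFunction.isIso_of_isDeflation h.extriangulated
    (h.isDeflation_of_isShortest hU hT hS hS.mem.2 hf) le_rfl
  exact (isUnit_iff_isIso f).2 this

variable {U T : 𝔼.Tors Θ}

theorem brick_eq_empty_iff (hUT : U ≤ T) :
    brick (U.1.rightOrthogonal ⊓ T.1) = ∅ ↔ U = T := by
  constructor
  · intro hempty
    by_contra hne
    obtain ⟨S, hS⟩ :=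
      h.exists_isShortest_of_not_le U.2 T.2.fac_le (hUT.lt_of_ne hne).not_ge
    exact Set.eq_empty_iff_forall_notMem.1 hempty _
      ⟨S, h.isBrick_of_isShortest U.2.fac_le T.2.fac_le hS, hS.mem, rfl⟩
  · rintro rfl
    refine Set.eq_empty_iff_forall_notMem.2 ?_
    rintro _ ⟨S, hS, hSU, rfl⟩
    exact hS.notMem_of_rightOrthogonal hSU.1 hSU.2

theorem wcovBy_of_subsingleton_brick (hUT : U ≤ T)
    (hsub : (brick (U.1.rightOrthogonal ⊓ T.1)).Subsingleton) : U ⩿ T := by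
  refine ⟨hUT, fun V hUV hVT => ?_⟩
  obtain ⟨S, hS⟩ := h.exists_isShortest_of_not_le U.2 V.2.fac_le hUV.not_ge
  obtain ⟨S', hS'⟩ := h.exists_isShortest_of_not_le V.2 T.2.fac_le hVT.not_ge
  have hbrick := h.isBrick_of_isShortest U.2.fac_le V.2.fac_le hS
  have hbrick' := h.isBrick_of_isShortest V.2.fac_le T.2.fac_le hS'
  obtain ⟨e⟩ : Nonempty (S ≅ S') := Quotient.exact (hsub
    ⟨S, hbrick, ⟨hS.mem.1, hVT.le _ hS.mem.2⟩, rfl⟩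
    ⟨S', hbrick', ⟨fun _ f hX => hS'.mem.1 f (hUV.le _ hX), hS'.mem.2⟩, rfl⟩)
  exact hbrick'.notMem_of_rightOrthogonal hS'.mem.1 (V.2.isoClosed.of_iso e hS.mem.2)

theorem covBy_of_encard_brick_eq_one (hUT : U ≤ T)
    (hcard : (brick (U.1.rightOrthogonal ⊓ T.1)).encard = 1) : U ⋖ T := by
  refine (h.wcovBy_of_subsingleton_brick hUT
    (Set.encard_le_one_iff_subsingleton.1 hcard.le)).covBy_of_ne fun heq => ?_
  rw [(h.brick_eq_empty_iff hUT).2 heq, Set.encard_empty] at hcard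
  exact zero_ne_one hcard

/-! ### Covers of torsion classes -/

variable {S X : C}

theorem exists_isDeflation_ne_zero_of_covBy (hUT : U ⋖ T) {F : C}
    (hF : (U.1.rightOrthogonal ⊓ T.1) F) (hF0 : ¬ IsZero F)
    (hX : (U.1.rightOrthogonal ⊓ T.1) X) (hX0 : ¬ IsZero X) :
    ∃ (F' : C) (y : F ⟶ F') (f : F' ⟶ X), 𝔼.IsDeflation Θ y ∧ f ≠ 0 := by
  let facF := 𝔼.Fac Θ (ObjectProperty.singleton F)
  let Q := U.1.rightOrthogonal ⊓ facF.rightOrthogonal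
  have hQ : 𝔼.Sub Θ Q ≤ Q := fun M ⟨N, x, hN, hx⟩ =>
    ⟨h.sub_rightOrthogonal_le U.2.fac_le M ⟨N, x, hN.1, hx⟩,
      h.sub_rightOrthogonal_le (h.lengthFunction.fac_fac_le h.extriangulated _) M
        ⟨N, x, hN.2, hx⟩⟩
  have hUQ : U.1 ≤ Q.leftOrthogonal := fun _ hM _ f hY => hY.1 f hM
  have hFQ : Q.leftOrthogonal F := fun _ f hY => hY.2 f (fac_singleton_iff.2
    ⟨𝟙 F, h.lengthFunction.isDeflation_of_iso h.extriangulated (Iso.refl F)⟩)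
  let V : 𝔼.Tors Θ := ⟨T.1 ⊓ Q.leftOrthogonal,
    T.2.inf (h.isTorsionClass_leftOrthogonal hQ) ⟨F, hF.2, hFQ⟩⟩
  have hUV : U ≤ V := le_inf hUT.le hUQ
  have hVT : V.1 ≤ T.1 := inf_le_left
  have hVne : V ≠ U := fun hVU =>
    hF0 (isZero_of_rightOrthogonal hF.1 (hVU ▸ (⟨hF.2, hFQ⟩ : V.1 F)))
  have hTV : T = V := ((hUT.eq_or_eq hUV hVT).resolve_left hVne).symm
  have hXQ : Q.leftOrthogonal X := (hTV ▸ hX.2 : V.1 X).2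
  by_contra! hvanish
  refine hX0 ((IsZero.iff_id_eq_zero X).2 (hXQ (𝟙 X) ⟨hX.1, fun F' f hF' => ?_⟩))
  obtain ⟨y, hy⟩ := fac_singleton_iff.1 hF'
  exact hvanish F' y f hy

theorem fac_singleton_of_covBy (hUT : U ⋖ T) (hS : IsShortest Θ (U.1.rightOrthogonal ⊓ T.1) S)
    (hX : (U.1.rightOrthogonal ⊓ T.1) X) (hX0 : ¬ IsZero X) :
    𝔼.Fac Θ (ObjectProperty.singleton X) S := by
  obtain ⟨X', y, f, hy, hf⟩ :=
    h.exists_isDeflation_ne_zero_of_covBy hUT hX hX0 hS.mem hS.not_isZero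
  have hX' : T.1 X' := T.2.fac_le _ ⟨X, y, hX.2, hy⟩
  exact fac_singleton_iff.2 ⟨y ≫ f, h.lengthFunction.isDeflation_comp h.extriangulated hy
    (h.isDeflation_of_isShortest U.2.fac_le T.2.fac_le hS hX' hf)⟩

theorem sub_singleton_of_covBy (hUT : U ⋖ T) (hS : IsShortest Θ (U.1.rightOrthogonal ⊓ T.1) S)
    (hX : (U.1.rightOrthogonal ⊓ T.1) X) (hX0 : ¬ IsZero X) :
    𝔼.Sub Θ (ObjectProperty.singleton X) S := by
  have hE := h.extriangulated
  have hΘ := h.lengthFunction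
  obtain ⟨S', y, f, hy, hf⟩ :=
    h.exists_isDeflation_ne_zero_of_covBy hUT hS.mem hS.not_isZero hX hX0
  obtain ⟨J, i, j, hi, hj, -, hJ0⟩ := h.admissible_of_ne_zero hf
  have hyi : 𝔼.IsDeflation Θ (y ≫ i) := hΘ.isDeflation_comp hE hy hi
  have hJ : (U.1.rightOrthogonal ⊓ T.1) J :=
    ⟨h.sub_rightOrthogonal_le U.2.fac_le _ ⟨X, j, hX.1, hj⟩,
      T.2.fac_le _ ⟨S, y ≫ i, hS.mem.2, hyi⟩⟩
  have := hΘ.isIso_of_isDeflation hE hyi (hS.length_le J hJ hJ0)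
  exact sub_singleton_iff.2
    ⟨_, hΘ.isInflation_comp hE (hΘ.isInflation_of_iso hE (asIso (y ≫ i))) hj⟩

theorem nonempty_iso_of_covBy (hUT : U ⋖ T) (hS : IsShortest Θ (U.1.rightOrthogonal ⊓ T.1) S)
    (hX : (U.1.rightOrthogonal ⊓ T.1) X) (hX0 : ¬ IsZero X) (hXS : Θ X ≤ Θ S) :
    Nonempty (X ≅ S) := by
  obtain ⟨f, hf⟩ := fac_singleton_iff.1 (h.fac_singleton_of_covBy hUT hS hX hX0)
  have := h.lengthFunction.isIso_of_isDeflation h.extriangulated hf hXS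
  exact ⟨asIso f⟩

theorem eq_inf_leftOrthogonal_of_covBy (hUT : U ⋖ T)
    (hS : IsShortest Θ (U.1.rightOrthogonal ⊓ T.1) S) :
    U.1 = T.1 ⊓ (ObjectProperty.singleton S).leftOrthogonal := by
  have := h.isIdempotentComplete
  apply le_antisymm
  · refine fun M hM => ⟨hUT.le _ hM, fun Y f hY => ?_⟩
    obtain rfl := (ObjectProperty.singleton_iff _ _).1 hY
    exact hS.mem.1 f hM
  · rintro M ⟨hM, hMS⟩
    by_contra hMU
    obtain ⟨F, y, hy, hF, hF0⟩ := h.exists_isDeflation_of_notMem U.2 T.2.fac_le hM hMU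
    obtain ⟨f, hf⟩ := fac_singleton_iff.1 (h.fac_singleton_of_covBy hUT hS hF hF0)
    have hyf := h.lengthFunction.isDeflation_comp h.extriangulated hy hf
    rw [hMS (y ≫ f) (ObjectProperty.singleton_iff S S |>.2 rfl)] at hyf
    exact hS.not_isZero (h.lengthFunction.isZero_of_isDeflation_zero h.extriangulated hyf)

end IsLengthCategory

end ExtriData

end ExtriLength

theorem theorem4_general {C : Type u} [Category.{v} C] [Preadditive C]
    [HasZeroObject C] [HasBinaryBiproducts C]
    (𝔼 : ExtriLength.ExtriData.{w} C) (Θ : C → ℕ) (h : 𝔼.IsLengthCategory Θ)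
    (U T : 𝔼.Tors Θ) (hUT : U ≤ T) :
    ((Set.Icc U T).encard = 1 ↔ ExtriLength.brick (U.1.rightOrthogonal ⊓ T.1) = ∅) ∧
    ((ExtriLength.brick (U.1.rightOrthogonal ⊓ T.1)).encard = 1 →
      (Set.Icc U T).encard = 2) ∧
    ((Set.Icc U T).encard = 2 →
      ∃ S : C, ExtriLength.IsBrick S ∧ (U.1.rightOrthogonal ⊓ T.1) S ∧
        (∀ S' : C, ExtriLength.IsBrick S' → (U.1.rightOrthogonal ⊓ T.1) S' → Θ S ≤ Θ S') ∧
        (T.1 = 𝔼.torsionClosure Θ (U.1 ⊔ ObjectProperty.singleton S) ∧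
          U.1 = T.1 ⊓ (ObjectProperty.singleton S).leftOrthogonal) ∧
        (∀ S' : C, ExtriLength.IsBrick S' → (U.1.rightOrthogonal ⊓ T.1) S' →
          𝔼.Sub Θ (ObjectProperty.singleton S') S ∧
          𝔼.Fac Θ (ObjectProperty.singleton S') S) ∧
        (∀ S₁ : C, ExtriLength.IsBrick S₁ → (U.1.rightOrthogonal ⊓ T.1) S₁ →
          (∀ S' : C, ExtriLength.IsBrick S' → (U.1.rightOrthogonal ⊓ T.1) S' → Θ S₁ ≤ Θ S') →
          Nonempty (S₁ ≅ S))) := by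
  rw [ExtriLength.encard_Icc_eq_one_iff, ExtriLength.encard_Icc_eq_two_iff_covBy]
  refine ⟨(h.brick_eq_empty_iff hUT).symm, h.covBy_of_encard_brick_eq_one hUT, fun hcov => ?_⟩
  obtain ⟨S, hS⟩ := h.exists_isShortest_of_not_le U.2 T.2.fac_le hcov.lt.not_ge
  have hbrick := h.isBrick_of_isShortest U.2.fac_le T.2.fac_le hS
  have hSU := hbrick.notMem_of_rightOrthogonal hS.mem.1
  exact ⟨S, hbrick, hS.mem,
    fun S' hS' hmem => hS.length_le S' hmem hS'.not_isZero,
    ⟨ExtriLength.ExtriData.eq_torsionClosure_of_covBy hcov hS.mem.2 hSU,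
      h.eq_inf_leftOrthogonal_of_covBy hcov hS⟩,
    fun S' hS' hmem => ⟨h.sub_singleton_of_covBy hcov hS hmem hS'.not_isZero,
      h.fac_singleton_of_covBy hcov hS hmem hS'.not_isZero⟩,
    fun S₁ hS₁ hmem hmin =>
      h.nonempty_iso_of_covBy hcov hS hmem hS₁.not_isZero (hmin S hbrick hS.mem)⟩

theorem theorem4 {C : Type u} [Category.{v} C] [Preadditive C]
    [HasFiniteBiproducts C] [HasBinaryBiproducts C]
    (hC : ExtriLength.IsKrullSchmidt C)
    (𝔼 : ExtriLength.ExtriData.{w} C) (Θ : C → ℕ) (h : 𝔼.IsLengthCategory Θ)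
    (U T : 𝔼.Tors Θ) (hUT : U ≤ T) :
    ((Set.Icc U T).encard = 1 ↔ ExtriLength.brick (U.1.rightOrthogonal ⊓ T.1) = ∅) ∧
    ((ExtriLength.brick (U.1.rightOrthogonal ⊓ T.1)).encard = 1 →
      (Set.Icc U T).encard = 2) ∧
    ((Set.Icc U T).encard = 2 →
      ∃ S : C, ExtriLength.IsBrick S ∧ (U.1.rightOrthogonal ⊓ T.1) S ∧
        (∀ S' : C, ExtriLength.IsBrick S' → (U.1.rightOrthogonal ⊓ T.1) S' → Θ S ≤ Θ S') ∧
        (T.1 = 𝔼.torsionClosure Θ (U.1 ⊔ ObjectProperty.singleton S) ∧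
          U.1 = T.1 ⊓ (ObjectProperty.singleton S).leftOrthogonal) ∧
        (∀ S' : C, ExtriLength.IsBrick S' → (U.1.rightOrthogonal ⊓ T.1) S' →
          𝔼.Sub Θ (ObjectProperty.singleton S') S ∧
          𝔼.Fac Θ (ObjectProperty.singleton S') S) ∧
        -- uniqueness up to isomorphism, already among the bricks of minimal length
        (∀ S₁ : C, ExtriLength.IsBrick S₁ → (U.1.rightOrthogonal ⊓ T.1) S₁ →
          (∀ S' : C, ExtriLength.IsBrick S' → (U.1.rightOrthogonal ⊓ T.1) S' → Θ S₁ ≤ Θ S') →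
          Nonempty (S₁ ≅ S))) :=
  theorem4_general 𝔼 Θ h U T hUT
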